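/- Let $P\subset\mathbb R^d$ be compact and let $\Omega=\bigsqcup_{n\ge 0}\Omega_n$, $\Omega_n\cong P^n$, be the space of finite configurations $\eta=(\eta_1,\dots,\eta_n)$ of points of $P$, with its disjoint-union Borel $\sigma$-algebra. For $\eta\in\Omega_n$ and $y\in P$ write $\mathsf N(\eta)=n$ and $\eta\oplus y=(y,\eta_1,\dots,\eta_n)\in\Omega_{n+1}$. Let $\lambda$ be a Markov kernel from $\Omega$ to $P$, that is, $\lambda(\eta,\cdot)$ is a Borel probability measure on $P$ for every $\eta\in\Omega$ and $\eta\mapsto\lambda(\eta,A)$ is measurable for every Borel set $A\subset P$. For bounded measurable $F:\Omega\to\mathbb R$ put $$LF(\eta)=\int_P\bigl[F(\eta\oplus y)-F(\eta)\bigr]\,\lambda(\eta,dy).$$ A *process generated by $L$* is an $\Omega$-valued Markov process $(\eta_t)_{t\ge0}$ whose transition semigroup $(T_t)_{t\ge 0}$ on bounded measurable functions has generator $L$ (i.e. $(T_hF-F)/h\to LF$ uniformly on $\Omega$ as $h\downarrow0$, for every bounded measurable $F$) and which starts from a one-point configuration, $\mathsf N(\eta_0)=1$ almost surely. Let $\mathscr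 G:\Omega\to[0,+\infty)$ be measurable and bounded, with $\mathscr G(\eta\oplus y)\le\mathscr G(\eta)$ for all $\eta\in\Omega$, $y\in P$. Let $\gamma\in(0,1)$, $\delta>0$, $\beta\in[0,1]$ be such that for every $\eta\in\Omega$ with $\mathsf N(\eta)\ge1$ there is a Borel set $B(\eta)\subset P$ with $\lambda(\eta,B(\eta))\ge\delta$ and $$\int_{B(\eta)}\bigl(\mathscr G(\eta)-\mathscr G(\eta\oplus y)\bigr)\,\lambda(\eta,dy)\ \ge\ \frac{\gamma\delta}{\mathsf N(\eta)^{\beta}}\,\mathscr G(\eta).$$ **Theorem.** There is a constant $c_{\mathscr G}>0$ (depending on $P,\lambda,\mathscr G,\gamma,\delta,\beta$, but not on the process, its initial law, $\varepsilon$ or $t$) such that for every process $(\eta_t)_{t\ge0}$ generated by $L$, all $\varepsilon>0$ and all $t\ge1$, $$\mathbb P\bigl(\mathscr G(\eta_t)>\varepsilon\bigr)\le\frac{c_{\mathscr G}}{\varepsilon}\,\mathbb E[\mathscr G(\eta_0)]\,\theta_\beta(t),\qquad \theta_\beta(t)=\begin{cases}e^{-\gamma\delta t}&\beta=0,\\ t^{1-1/\beta}&\beta\in(0,1),\\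 1/\log(1+t)&\beta=1.\end{cases}$$ In particular, $\mathscr G(\eta_t)\to0$ in probability as $t\to\infty$. -/

import Mathlib

open MeasureTheory ProbabilityTheory Filter Topology
open scoped NNReal

/-- Finite configurations `(η₁, …, ηₙ, φ, φ, …)`, `n ≥ 0`, of points of `α`, i.e. the disjoint union
`Ω = ⨆ₙ Ωₙ` with `Ωₙ ≅ αⁿ`. It carries the disjoint-union measurable structure of the product
`σ`-algebras (Mathlib's instance on `Σ`-types); `Config.measurableSpace_eq_borel` below shows that
this is the Borel `σ`-algebra of the metric `Config.configDist`. -/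
abbrev Config (α : Type*) : Type _ := Σ n : ℕ, (Fin n → α)

namespace Config

/-- The number `N(η)` of points of the configuration `η`. -/
def count {α : Type*} (η : Config α) : ℕ := η.1

/-- The configuration `η ⊕ y = (y, η₁, …, ηₙ, φ, …)`. -/
def push {α : Type*} (η : Config α) (y : α) : Config α := ⟨η.1 + 1, Fin.cons y η.2⟩

/-- The `i`-th entry of `η` (counted from `0`); `none` is the graveyard state `φ`. -/
def coord {α : Type*} (η : Config α) (i : ℕ) : Option α :=
  if h : i < η.1 then some (η.2 ⟨i, h⟩) else none

/-- The distance between two entries: the distance of `α` between two points, the diameter of `α`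
between a point and the graveyard state. -/
noncomputable def entryDist {α : Type*} [PseudoMetricSpace α] : Option α → Option α → ℝ
  | some p, some q => dist p q
  | some _, none => Metric.diam (Set.univ : Set α)
  | none, some _ => Metric.diam (Set.univ : Set α)
  | none, none => 0

/-- The metric `∑_{i ≥ 1} 2⁻ⁱ d(ηᵢ, σᵢ)` on configurations (entries are counted from `0` here). -/
noncomputable def configDist {α : Type*} [PseudoMetricSpace α] (η σ : Config α) : ℝ :=
  ∑' i : ℕ, (1 / 2 : ℝ) ^ (i + 1) * entryDist (η.coord i) (σ.coord i)

/-- `U` is open for the metric `configDist`. -/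
def IsOpenConfig {α : Type*} [PseudoMetricSpace α] (U : Set (Config α)) : Prop :=
  ∀ η ∈ U, ∃ r > 0, ∀ σ, configDist η σ < r → σ ∈ U

section Borel

theorem entryDist_nonneg {α : Type*} [PseudoMetricSpace α] (a b : Option α) :
    0 ≤ entryDist a b := by
  cases a <;> cases b <;> simp [entryDist, Metric.diam_nonneg]

theorem entryDist_le {α : Type*} [PseudoMetricSpace α] [CompactSpace α] (a b : Option α) :
    entryDist a b ≤ Metric.diam (Set.univ : Set α) := by
  cases a <;> cases b <;> simp only [entryDist, le_refl, Metric.diam_nonneg]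
  exact Metric.dist_le_diam_of_mem isCompact_univ.isBounded (Set.mem_univ _) (Set.mem_univ _)

theorem summable_half : Summable (fun i : ℕ => (1 / 2 : ℝ) ^ (i + 1)) := by
  simpa [pow_succ] using summable_geometric_two.mul_right (1 / 2 : ℝ)

theorem tsum_half : ∑' i : ℕ, (1 / 2 : ℝ) ^ (i + 1) = 1 := by
  simp only [pow_succ]
  rw [tsum_mul_right, tsum_geometric_two]
  norm_num

theorem summable_configDist {α : Type*} [PseudoMetricSpace α] [CompactSpace α] (η σ : Config α) :
    Summable (fun i : ℕ => (1 / 2 : ℝ) ^ (i + 1) * entryDist (η.coord i) (σ.coord i)) := by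
  refine Summable.of_nonneg_of_le
    (fun i => mul_nonneg (by positivity) (entryDist_nonneg _ _))
    (fun i => mul_le_mul_of_nonneg_left (entryDist_le _ _) (by positivity))
    (summable_half.mul_right (Metric.diam (Set.univ : Set α)))

theorem term_le_configDist {α : Type*} [PseudoMetricSpace α] [CompactSpace α] (η σ : Config α)
    (i : ℕ) : (1 / 2 : ℝ) ^ (i + 1) * entryDist (η.coord i) (σ.coord i) ≤ configDist η σ :=
  (summable_configDist η σ).le_tsum i
    (fun j _ => mul_nonneg (by positivity) (entryDist_nonneg _ _))

theorem configDist_mk_le {α : Type*} [PseudoMetricSpace α] [CompactSpace α] {n : ℕ}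
    (x y : Fin n → α) : configDist (⟨n, x⟩ : Config α) ⟨n, y⟩ ≤ dist x y := by
  have h : ∀ i : ℕ, entryDist (coord (⟨n, x⟩ : Config α) i) (coord (⟨n, y⟩ : Config α) i)
      ≤ dist x y := by
    intro i
    by_cases hi : i < n
    · simp only [coord, hi, dite_true, entryDist]
      exact dist_le_pi_dist x y ⟨i, hi⟩
    · simp only [coord, hi, dite_false, entryDist]
      exact dist_nonneg
  calc configDist (⟨n, x⟩ : Config α) ⟨n, y⟩
      ≤ ∑' i : ℕ, (1 / 2 : ℝ) ^ (i + 1) * dist x y :=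
        (summable_configDist _ _).tsum_le_tsum
          (fun i => mul_le_mul_of_nonneg_left (h i) (by positivity))
          (summable_half.mul_right _)
    _ = dist x y := by rw [tsum_mul_right, tsum_half, one_mul]

theorem diam_pos_of_nontrivial {α : Type*} [MetricSpace α] [CompactSpace α] [Nontrivial α] :
    0 < Metric.diam (Set.univ : Set α) := by
  obtain ⟨a, b, hab⟩ := exists_pair_ne α
  exact (dist_pos.2 hab).trans_le
    (Metric.dist_le_diam_of_mem isCompact_univ.isBounded (Set.mem_univ _) (Set.mem_univ _))

theorem fst_eq_of_configDist_lt {α : Type*} [MetricSpace α] [CompactSpace α]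
    (η σ : Config α)
    (h : configDist η σ < (1 / 2 : ℝ) ^ (η.1 + 1) * Metric.diam (Set.univ : Set α)) :
    σ.1 = η.1 := by
  have hd : 0 ≤ Metric.diam (Set.univ : Set α) := Metric.diam_nonneg
  rcases lt_trichotomy σ.1 η.1 with hlt | heq | hgt
  · exfalso
    have h1 := term_le_configDist η σ σ.1
    simp only [coord, hlt, dite_true, lt_irrefl, dite_false, entryDist] at h1
    have h2 : (1 / 2 : ℝ) ^ (η.1 + 1) ≤ (1 / 2 : ℝ) ^ (σ.1 + 1) :=
      pow_le_pow_of_le_one (by norm_num) (by norm_num) (by omega)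
    have h3 := mul_le_mul_of_nonneg_right h2 hd
    linarith
  · exact heq
  · exfalso
    have h1 := term_le_configDist η σ η.1
    simp only [coord, hgt, dite_true, lt_irrefl, dite_false, entryDist] at h1
    linarith

theorem isOpenConfig_image {α : Type*} [MetricSpace α] [CompactSpace α] [Nontrivial α] {n : ℕ}
    {A : Set (Fin n → α)} (hA : IsOpen A) :
    IsOpenConfig ((fun x : Fin n → α => (⟨n, x⟩ : Config α)) '' A) := by
  rintro _ ⟨x, hx, rfl⟩
  obtain ⟨r, hr, hball⟩ := Metric.isOpen_iff.1 hA x hx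
  have hD := diam_pos_of_nontrivial (α := α)
  refine ⟨min ((1 / 2 : ℝ) ^ (n + 1) * Metric.diam (Set.univ : Set α)) ((1 / 2 : ℝ) ^ (n + 1) * r),
    lt_min (by positivity) (by positivity), ?_⟩
  intro σ hσ
  have hn := fst_eq_of_configDist_lt ⟨n, x⟩ σ (hσ.trans_le (min_le_left _ _))
  obtain ⟨m, y⟩ := σ
  obtain rfl : m = n := hn
  refine ⟨y, hball ?_, rfl⟩
  rw [Metric.mem_ball, dist_comm, dist_pi_lt_iff hr]
  intro i
  have h1 := term_le_configDist (⟨m, x⟩ : Config α) ⟨m, y⟩ i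
  simp only [coord, i.2, dite_true, entryDist] at h1
  have h2 := h1.trans_lt (hσ.trans_le (min_le_right _ _))
  have h3 : (1 / 2 : ℝ) ^ (m + 1) * dist (x i) (y i)
      ≤ (1 / 2 : ℝ) ^ ((i : ℕ) + 1) * dist (x i) (y i) :=
    mul_le_mul_of_nonneg_right
      (pow_le_pow_of_le_one (by norm_num) (by norm_num) (by omega)) dist_nonneg
  exact lt_of_mul_lt_mul_left (h3.trans_lt h2) (by positivity)

/-- The measurable structure of `Config α` is the Borel `σ`-algebra of the metric `configDist`. -/
theorem measurableSpace_eq_borel {α : Type*} [MetricSpace α] [CompactSpace α] [Nontrivial α]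
    [MeasurableSpace α] [BorelSpace α] :
    (inferInstance : MeasurableSpace (Config α)) =
      MeasurableSpace.generateFrom {U : Set (Config α) | IsOpenConfig U} := by
  have hm : ∀ S : Set (Config α), MeasurableSet S ↔
      ∀ n, MeasurableSet ((fun x : Fin n → α => (⟨n, x⟩ : Config α)) ⁻¹' S) := by
    intro S
    simp only [MeasurableSpace.measurableSet_iInf, MeasurableSpace.map_def]
  apply le_antisymm
  · intro S hS
    have hS' := (hm S).1 hS
    have himg : ∀ (n : ℕ) (A : Set (Fin n → α)), MeasurableSet A →
        MeasurableSet[MeasurableSpace.generateFrom {U : Set (Config α) | IsOpenConfig U}]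
          ((fun x : Fin n → α => (⟨n, x⟩ : Config α)) '' A) := by
      intro n A hA
      have hinj : Function.Injective (fun x : Fin n → α => (⟨n, x⟩ : Config α)) :=
        fun x y h => eq_of_heq (Sigma.mk.inj h).2
      rw [BorelSpace.measurable_eq (α := Fin n → α)] at hA
      induction A, hA using MeasurableSpace.generateFrom_induction with
      | hC t ht _ => exact MeasurableSpace.measurableSet_generateFrom (isOpenConfig_image ht)
      | empty => simp
      | compl t _ ih =>
        rw [Set.compl_eq_univ_sdiff, Set.image_sdiff hinj]
        exact MeasurableSet.diff
          (MeasurableSpace.measurableSet_generateFrom (isOpenConfig_image isOpen_univ)) ih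
      | iUnion s _ ih =>
        rw [Set.image_iUnion]
        exact MeasurableSet.iUnion ih
    have hSU : S = ⋃ n, (fun x : Fin n → α => (⟨n, x⟩ : Config α)) ''
        ((fun x : Fin n → α => (⟨n, x⟩ : Config α)) ⁻¹' S) := by
      ext ⟨n, x⟩
      simp only [Set.mem_iUnion, Set.mem_image, Set.mem_preimage]
      constructor
      · intro h
        exact ⟨n, x, h, rfl⟩
      · rintro ⟨m, y, hy, h⟩
        rwa [h] at hy
    rw [hSU]
    exact MeasurableSet.iUnion (fun n => himg n _ (hS' n))
  · apply MeasurableSpace.generateFrom_le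
    intro U hU
    rw [hm]
    intro n
    apply IsOpen.measurableSet
    rw [Metric.isOpen_iff]
    intro x hx
    obtain ⟨r, hr, h⟩ := hU _ hx
    refine ⟨r, hr, fun y hy => h _ ?_⟩
    rw [Metric.mem_ball, dist_comm] at hy
    exact (configDist_mk_le x y).trans_lt hy

end Borel

end Config

/-- `F` is a bounded measurable real function. -/
def IsBoundedMeasurable {S : Type*} [MeasurableSpace S] (F : S → ℝ) : Prop :=
  Measurable F ∧ ∃ C : ℝ, ∀ x, |F x| ≤ C

/-- The operator `L F(η) = ∫ (F(η ⊕ y) - F(η)) lam(η, dy)`. -/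
noncomputable def greedyGenerator {α : Type*} [MeasurableSpace α] (lam : Kernel (Config α) α)
    (F : Config α → ℝ) (η : Config α) : ℝ :=
  ∫ y, (F (η.push y) - F η) ∂(lam η)

/-- `(T t)_{t ≥ 0}` is a Markov transition function on `S` (the last field is the
Chapman–Kolmogorov equation). -/
structure IsTransitionFunction {S : Type*} [MeasurableSpace S] (T : ℝ≥0 → Kernel S S) : Prop where
  isMarkovKernel : ∀ t, IsMarkovKernel (T t)
  zero : T 0 = Kernel.id
  add : ∀ s t, T (s + t) = T t ∘ₖ T s

/-- The semigroup of `T` on bounded measurable functions has the bounded generator `L`: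
`(T_h F - F) / h → L F` in the supremum norm as `h ↓ 0`, for every bounded measurable `F`. -/
def HasBoundedGenerator {S : Type*} [MeasurableSpace S] (T : ℝ≥0 → Kernel S S)
    (L : (S → ℝ) → S → ℝ) : Prop :=
  ∀ F : S → ℝ, IsBoundedMeasurable F →
    TendstoUniformly (fun (h : ℝ≥0) (x : S) => ((∫ z, F z ∂(T h x)) - F x) / (h : ℝ)) (L F)
      (𝓝[>] 0)

/-- The `σ`-algebra generated by `X r`, `r ≤ s`. -/
abbrev pastSigma {W S : Type*} [MeasurableSpace S] (X : ℝ≥0 → W → S) (s : ℝ≥0) : MeasurableSpace W :=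
  ⨆ r : ℝ≥0, ⨆ _ : r ≤ s, MeasurableSpace.comap (X r) inferInstance

/-- `X` is, under `Pr`, a Markov process (for its own filtration) with transition function `T`. -/
structure IsMarkovProcess {W S : Type*} [MeasurableSpace W] [MeasurableSpace S]
    (Pr : Measure W) (X : ℝ≥0 → W → S) (T : ℝ≥0 → Kernel S S) : Prop where
  measurable : ∀ t, Measurable (X t)
  markov : ∀ s t : ℝ≥0, ∀ F : S → ℝ, IsBoundedMeasurable F →
    Pr[fun w => F (X (s + t) w) | pastSigma X s] =ᵐ[Pr] fun w => ∫ z, F z ∂(T t (X s w))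

/-- `X` is a process generated by `greedyGenerator lam` that starts from a one-point configuration:
a Markov process on configurations whose transition function has generator `greedyGenerator lam`. -/
def IsGreedyProcess {W α : Type*} [MeasurableSpace W] [MeasurableSpace α]
    (lam : Kernel (Config α) α) (Pr : Measure W) (X : ℝ≥0 → W → Config α) : Prop :=
  (∃ T : ℝ≥0 → Kernel (Config α) (Config α), IsTransitionFunction T ∧
    HasBoundedGenerator T (greedyGenerator lam) ∧ IsMarkovProcess Pr X T) ∧
  ∀ᵐ w ∂Pr, (X 0 w).count = 1

/-- A measurable global error function `G ≥ 0` that is bounded and monotone. -/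
structure IsGlobalError {α : Type*} [MeasurableSpace α] (G : Config α → ℝ) : Prop where
  measurable : Measurable G
  nonneg : ∀ η, 0 ≤ G η
  bounded : ∃ c₀ : ℝ, ∀ η, G η ≤ c₀
  monotone : ∀ η y, G (η.push y) ≤ G η

/-- The improvement-factor condition with parameters `γ`, `δ`, `β`. The empty configuration, which
the process never visits and where the factor `N(η)^{-β}` is meaningless for `β > 0`, is exempt. -/
def ImprovementFactor {α : Type*} [MeasurableSpace α] (lam : Kernel (Config α) α)
    (G : Config α → ℝ) (γ δ β : ℝ) : Prop :=
  ∀ η : Config α, 1 ≤ η.count → ∃ B : Set α, MeasurableSet B ∧ δ ≤ (lam η).real B ∧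
    γ * δ / (η.count : ℝ) ^ β * G η ≤ ∫ y in B, (G η - G (η.push y)) ∂(lam η)

/-- The rate `θ_β(t)`, for `β ∈ [0, 1]`. -/
noncomputable def greedyRate (γ δ β t : ℝ) : ℝ :=
  if β = 0 then Real.exp (-(γ * δ * t))
  else if β < 1 then t ^ (1 - 1 / β)
  else 1 / Real.log (1 + t)

/-! The test functions are `ψ(N) G`, with `ψ` a nonnegative bounded weight in the number of points.
Each push raises `N` by one and shrinks `G` on average by the factor `1 - γδ/N^β`. If `ψ(n+1)(1 -
γδ/n^β) ≤ (1 - r) ψ(n)`, then `L(ψ(N)G) ≤ -r ψ(N)G` along the process, so `E[ψ(N_t)G_t] ≤ e^{-rt}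
ψ(1) E[G_0]` (`IsGreedyProcess.integral_weight_le`).

For `β = 0` the weight `1` with `r = γδ` suffices. For `β > 0` two weights are combined. A truncated
`(N+K)^p` has `r = 0` and gains a factor `t^{-p}` where `N ≥ t/2`. The weight `2^{-N}` has `r = 1/2`
and makes the part where `N < t/2` exponentially small, in place of a Poisson tail estimate. A sum
of the two, with coefficients depending on `t`, dominates `1`, so `E[G_t] ≤ c t^{-p} E[G_0]`.
Markov's inequality finishes the proof. -/

theorem Config.measurable_push {α : Type*} [MeasurableSpace α] (η : Config α) :
    Measurable (fun y => η.push y) := by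
  have h1 : Measurable (fun x : Fin (η.1 + 1) → α => (⟨η.1 + 1, x⟩ : Config α)) :=
    Measurable.of_le_map (iInf_le _ _)
  refine h1.comp (measurable_pi_lambda _ fun i => ?_)
  refine Fin.cases ?_ (fun j => ?_) i
  · exact measurable_id
  · simp

theorem Config.measurable_count {α : Type*} [MeasurableSpace α] :
    Measurable (Config.count : Config α → ℕ) := by
  intro s _
  simp only [MeasurableSpace.measurableSet_iInf, MeasurableSpace.map_def]
  intro n
  exact MeasurableSet.const (n ∈ s)

@[simp] theorem Config.count_push {α : Type*} (η : Config α) (y : α) :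
    (η.push y).count = η.count + 1 := rfl

/-! ### From a generator inequality to exponential decay of expectations. -/

theorem IsBoundedMeasurable.integrable_comp {W S : Type*} [MeasurableSpace W] [MeasurableSpace S]
    {F : S → ℝ} (hF : IsBoundedMeasurable F) (μ : Measure W) [IsFiniteMeasure μ] {X : W → S}
    (hX : Measurable X) : Integrable (fun w => F (X w)) μ := by
  obtain ⟨hm, C, hC⟩ := hF
  exact Integrable.of_bound (hm.comp hX).aestronglyMeasurable C (ae_of_all _ fun w => hC _)

/-- One step of the Euler scheme. -/
theorem IsMarkovProcess.integral_step {W S : Type*} [MeasurableSpace W] [MeasurableSpace S]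
    {Pr : Measure W} [IsProbabilityMeasure Pr] {X : ℝ≥0 → W → S} {T : ℝ≥0 → Kernel S S}
    (hX : IsMarkovProcess Pr X T) (hT : IsTransitionFunction T)
    {F : S → ℝ} (hF : IsBoundedMeasurable F) (s t : ℝ≥0) {a b : ℝ}
    (h : ∀ᵐ w ∂Pr, ∫ z, F z ∂(T t (X s w)) ≤ a * F (X s w) + b) :
    ∫ w, F (X (s + t) w) ∂Pr ≤ a * (∫ w, F (X s w) ∂Pr) + b := by
  have hle : pastSigma X s ≤ (inferInstance : MeasurableSpace W) :=
    iSup₂_le fun r _ => (hX.measurable r).comap_le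
  have := hT.isMarkovKernel t
  have hFs := hF.integrable_comp Pr (hX.measurable s)
  have hint : Integrable (fun w => ∫ z, F z ∂(T t (X s w))) Pr := by
    refine IsBoundedMeasurable.integrable_comp (F := fun x => ∫ z, F z ∂(T t x)) ⟨?_, ?_⟩ Pr
      (hX.measurable s)
    · exact (hF.1.stronglyMeasurable.integral_kernel (κ := T t)).measurable
    · obtain ⟨C, hC⟩ := hF.2
      refine ⟨C, fun x => ?_⟩
      simpa using norm_integral_le_of_norm_le_const (μ := T t x) (f := F) (C := C)
        (ae_of_all _ hC)
  calc ∫ w, F (X (s + t) w) ∂Pr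
      = ∫ w, (Pr[fun w => F (X (s + t) w) | pastSigma X s]) w ∂Pr := (integral_condExp hle).symm
    _ = ∫ w, (∫ z, F z ∂(T t (X s w))) ∂Pr := integral_congr_ae (hX.markov s t F hF)
    _ ≤ ∫ w, (a * F (X s w) + b) ∂Pr :=
        integral_mono_ae hint ((hFs.const_mul a).add (integrable_const b)) h
    _ = a * (∫ w, F (X s w) ∂Pr) + b := by
        rw [integral_add (hFs.const_mul a) (integrable_const b), integral_const_mul]
        simp

/-- If `L F ≤ -r F` along the process, then `E[F(X_t)] ≤ exp(-r t) E[F(X_0)]`. -/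
theorem IsMarkovProcess.integral_le_exp {W S : Type*} [MeasurableSpace W] [MeasurableSpace S]
    {Pr : Measure W} [IsProbabilityMeasure Pr] {X : ℝ≥0 → W → S} {T : ℝ≥0 → Kernel S S}
    (hX : IsMarkovProcess Pr X T) (hT : IsTransitionFunction T) {L : (S → ℝ) → S → ℝ}
    (hL : HasBoundedGenerator T L) {F : S → ℝ} (hF : IsBoundedMeasurable F) (hF0 : ∀ x, 0 ≤ F x)
    {r : ℝ} (h : ∀ s, ∀ᵐ w ∂Pr, L F (X s w) ≤ -r * F (X s w)) (t : ℝ≥0) :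
    ∫ w, F (X t w) ∂Pr ≤ Real.exp (-r * t) * ∫ w, F (X 0 w) ∂Pr := by
  rcases eq_or_ne t 0 with rfl | ht
  · simp
  have ht' : 0 < (t : ℝ) := by exact_mod_cast pos_iff_ne_zero.2 ht
  refine le_of_forall_pos_le_add fun e he => ?_
  set u : ℝ≥0 → ℝ := fun s => ∫ w, F (X s w) ∂Pr with hu
  have hu0 : ∀ s, 0 ≤ u s := fun s => integral_nonneg fun w => hF0 _
  -- Chosen so that the errors accumulated up to time `t`, at most `exp(|r| t) * e' * t`, amount to
  -- `e`.
  set e' : ℝ := e / (t * Real.exp (|r| * t)) with he'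
  have he'0 : 0 < e' := by positivity
  have hev := Metric.tendstoUniformly_iff.1 (hL F hF) e' he'0
  have hseq : Tendsto (fun n : ℕ => t / ((n : ℝ≥0) + 1)) atTop (𝓝[>] 0) := by
    refine tendsto_nhdsWithin_iff.2 ⟨?_, Eventually.of_forall fun n => ?_⟩
    · rw [← NNReal.tendsto_coe]
      push_cast
      simpa [Function.comp_def] using
        (tendsto_const_div_atTop_nhds_zero_nat (t : ℝ)).comp (tendsto_add_atTop_nat 1)
    · simp only [Set.mem_Ioi]; positivity
  obtain ⟨n, hn⟩ := (hseq.eventually hev).exists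
  set k : ℝ≥0 := t / ((n : ℝ≥0) + 1) with hk
  have hk0 : 0 < (k : ℝ) := by
    have : 0 < k := by positivity
    exact_mod_cast this
  have hkt : ((n : ℝ) + 1) * k = t := by
    rw [hk]; push_cast; field_simp
  have step : ∀ s, u (s + k) ≤ Real.exp (-r * k) * u s + e' * k := by
    intro s
    refine hX.integral_step hT hF s k ?_
    filter_upwards [h s] with w hw
    have h1 := (abs_lt.1 (by simpa [Real.dist_eq] using hn (X s w))).1
    have h2 : ((∫ z, F z ∂(T k (X s w))) - F (X s w)) / k ≤ -r * F (X s w) + e' := by linarith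
    rw [div_le_iff₀ hk0] at h2
    -- The Euler factor `1 - r k` is replaced by `exp(-r k)`; this needs `F ≥ 0`.
    have h3 := mul_le_mul_of_nonneg_right (Real.add_one_le_exp (-r * k)) (hF0 (X s w))
    linarith
  -- The factor `exp(|r| m k)` absorbs the propagation of earlier errors, whatever the sign of `r`.
  have iter : ∀ m : ℕ, u (m * k) ≤
      Real.exp (-r * (m * k)) * u 0 + Real.exp (|r| * (m * k)) * (e' * (m * k)) := by
    intro m
    induction m with
    | zero => simp
    | succ m ih =>
      have h1 := step (m * k)
      have h2 : ((m + 1 : ℕ) : ℝ≥0) * k = m * k + k := by push_cast; ring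
      rw [h2]
      have h3 := mul_le_mul_of_nonneg_left ih (Real.exp_pos (-r * k)).le
      have h4 : Real.exp (-r * k) ≤ Real.exp (|r| * k) :=
        Real.exp_le_exp.2 (mul_le_mul_of_nonneg_right (neg_le_abs r) hk0.le)
      have h5 : Real.exp (-r * ((m + 1 : ℕ) * k)) = Real.exp (-r * k) * Real.exp (-r * (m * k)) := by
        rw [← Real.exp_add]; push_cast; ring_nf
      have h6 : Real.exp (|r| * ((m + 1 : ℕ) * k)) =
          Real.exp (|r| * k) * Real.exp (|r| * (m * k)) := by
        rw [← Real.exp_add]; push_cast; ring_nf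
      have h7 : (1 : ℝ) ≤ Real.exp (|r| * ((m + 1 : ℕ) * k)) := Real.one_le_exp (by positivity)
      have h8 := mul_le_mul_of_nonneg_right h4
        (by positivity : 0 ≤ Real.exp (|r| * (m * k)) * (e' * (m * k)))
      have h9 := mul_le_mul_of_nonneg_right h7 (by positivity : 0 ≤ e' * (k : ℝ))
      rw [h5]
      have h10 : Real.exp (|r| * ((m + 1 : ℕ) * k)) * (e' * ((m + 1 : ℕ) * k)) =
          Real.exp (|r| * k) * (Real.exp (|r| * (m * k)) * (e' * (m * k))) +
          Real.exp (|r| * ((m + 1 : ℕ) * k)) * (e' * k) := by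
        rw [h6]; push_cast; ring
      rw [h10]
      linarith
  have hfin := iter (n + 1)
  have hkt' : ((n + 1 : ℕ) : ℝ≥0) * k = t := by
    apply NNReal.coe_injective; push_cast; exact hkt
  rw [hkt'] at hfin
  push_cast at hfin
  rw [hkt] at hfin
  have : Real.exp (|r| * t) * (e' * t) = e := by rw [he']; field_simp
  linarith

/-! ### Weighted error functions along the process. -/

section Greedy

variable {α W : Type*} [MeasurableSpace α] [MeasurableSpace W] {lam : Kernel (Config α) α}
  {Pr : Measure W} {X : ℝ≥0 → W → Config α}

theorem IsGreedyProcess.measurable (hX : IsGreedyProcess lam Pr X) (t : ℝ≥0) :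
    Measurable (X t) := by
  obtain ⟨⟨T, _, _, h⟩, _⟩ := hX
  exact h.measurable t

variable [IsProbabilityMeasure Pr]

theorem IsGreedyProcess.integral_le_exp (hX : IsGreedyProcess lam Pr X) {F : Config α → ℝ}
    (hF : IsBoundedMeasurable F) (hF0 : ∀ x, 0 ≤ F x) {r : ℝ}
    (h : ∀ s, ∀ᵐ w ∂Pr, greedyGenerator lam F (X s w) ≤ -r * F (X s w)) (t : ℝ≥0) :
    ∫ w, F (X t w) ∂Pr ≤ Real.exp (-r * t) * ∫ w, F (X 0 w) ∂Pr := by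
  obtain ⟨⟨T, hT, hL, hM⟩, _⟩ := hX
  exact hM.integral_le_exp hT hL hF hF0 h t

/-- The indicator of the empty configuration vanishes after any push, so its generator is
nonpositive and its expectation stays at its initial value `0`. This makes `ImprovementFactor`
available almost surely at each time. -/
theorem IsGreedyProcess.one_le_count (hX : IsGreedyProcess lam Pr X) (t : ℝ≥0) :
    ∀ᵐ w ∂Pr, 1 ≤ (X t w).count := by
  set F : Config α → ℝ := fun η => if η.count = 0 then 1 else 0 with hF
  have hFm : IsBoundedMeasurable F := by
    refine ⟨(measurable_of_countable (fun n : ℕ => if n = 0 then (1 : ℝ) else 0)).comp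
      Config.measurable_count, 1, fun η => ?_⟩
    simp only [hF]; split_ifs <;> simp
  have hF0 : ∀ η, 0 ≤ F η := fun η => by simp only [hF]; split_ifs <;> simp
  have hgen : ∀ η, greedyGenerator lam F η ≤ -0 * F η := by
    intro η
    simp only [greedyGenerator, neg_zero, zero_mul]
    refine integral_nonpos fun y => ?_
    have : F (η.push y) = 0 := by simp [hF]
    simpa [this] using hF0 η
  have h0 : ∫ w, F (X 0 w) ∂Pr = 0 := by
    refine integral_eq_zero_of_ae ?_
    filter_upwards [hX.2] with w hw
    simp [hF, hw]
  have h1 := hX.integral_le_exp hFm hF0 (fun s => ae_of_all _ fun w => hgen _) t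
  rw [h0, mul_zero] at h1
  have h2 := (integral_eq_zero_iff_of_nonneg (fun w => hF0 (X t w))
    (hFm.integrable_comp Pr (hX.measurable t))).1
    (le_antisymm h1 (integral_nonneg fun w => hF0 _))
  filter_upwards [h2] with w hw
  by_contra hc
  have : (X t w).count = 0 := by omega
  simp [hF, this] at hw

variable [IsMarkovKernel lam] {G : Config α → ℝ} {γ δ β : ℝ}

theorem IsGlobalError.isBoundedMeasurable_weight (hG : IsGlobalError G) {ψ : ℕ → ℝ} {C : ℝ}
    (hψ0 : ∀ n, 0 ≤ ψ n) (hψC : ∀ n, ψ n ≤ C) :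
    IsBoundedMeasurable (fun η => ψ η.count * G η) := by
  obtain ⟨c₀, hc₀⟩ := hG.bounded
  refine ⟨((measurable_of_countable ψ).comp Config.measurable_count).mul hG.measurable, C * c₀,
    fun η => ?_⟩
  rw [abs_of_nonneg (mul_nonneg (hψ0 _) (hG.nonneg _))]
  exact mul_le_mul (hψC _) (hc₀ _) (hG.nonneg _) ((hψ0 0).trans (hψC 0))

theorem IsGlobalError.integrable_push (hG : IsGlobalError G) (η : Config α) :
    Integrable (fun y => G (η.push y)) (lam η) := by
  obtain ⟨c₀, hc₀⟩ := hG.bounded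
  refine Integrable.of_bound (hG.measurable.comp η.measurable_push).aestronglyMeasurable c₀
    (ae_of_all _ fun y => ?_)
  rw [Real.norm_of_nonneg (hG.nonneg _)]
  exact hc₀ _

/-- By monotonicity of `G` the gain is nonnegative off `B` too, so the gain over `B` bounds the
total gain from below. -/
theorem ImprovementFactor.integral_push_le (hG : IsGlobalError G)
    (h : ImprovementFactor lam G γ δ β) {η : Config α} (hη : 1 ≤ η.count) :
    ∫ y, G (η.push y) ∂(lam η) ≤ (1 - γ * δ / (η.count : ℝ) ^ β) * G η := by
  obtain ⟨B, _, _, hB⟩ := h η hη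
  have hi : Integrable (fun y => G η - G (η.push y)) (lam η) :=
    (integrable_const _).sub (hG.integrable_push η)
  have h1 := setIntegral_le_integral (s := B) hi
    (ae_of_all _ fun y => sub_nonneg.2 (hG.monotone η y))
  have h2 : ∫ y, (G η - G (η.push y)) ∂(lam η) = G η - ∫ y, G (η.push y) ∂(lam η) := by
    rw [integral_sub (integrable_const _) (hG.integrable_push η)]; simp
  linarith

/-- Decay of the weighted expectations `E[ψ(N(X_t)) G(X_t)]`. -/
theorem IsGreedyProcess.integral_weight_le (hX : IsGreedyProcess lam Pr X) (hG : IsGlobalError G)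
    (h : ImprovementFactor lam G γ δ β) {ψ : ℕ → ℝ} {C r : ℝ}
    (hψ0 : ∀ n, 0 ≤ ψ n) (hψC : ∀ n, ψ n ≤ C)
    (hψ : ∀ n : ℕ, 1 ≤ n → ψ (n + 1) * (1 - γ * δ / (n : ℝ) ^ β) ≤ (1 - r) * ψ n) (t : ℝ≥0) :
    ∫ w, ψ (X t w).count * G (X t w) ∂Pr ≤
      Real.exp (-r * t) * ψ 1 * ∫ w, G (X 0 w) ∂Pr := by
  have h1 := hX.integral_le_exp (hG.isBoundedMeasurable_weight hψ0 hψC)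
    (fun η => mul_nonneg (hψ0 _) (hG.nonneg _)) (r := r) (fun s => by
      filter_upwards [hX.one_le_count s] with w hw
      set η := X s w
      simp only [greedyGenerator, Config.count_push]
      rw [integral_sub ((hG.integrable_push η).const_mul _) (integrable_const _),
        integral_const_mul]
      simp only [integral_const, probReal_univ, one_smul]
      have h2 := mul_le_mul_of_nonneg_left (h.integral_push_le hG hw) (hψ0 (η.count + 1))
      have h3 := mul_le_mul_of_nonneg_right (hψ _ hw) (hG.nonneg η)
      linarith) t
  -- The one-point start turns the initial weight into the constant `ψ 1`.
  have h2 : ∫ w, ψ (X 0 w).count * G (X 0 w) ∂Pr = ψ 1 * ∫ w, G (X 0 w) ∂Pr := by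
    rw [← integral_const_mul]
    refine integral_congr_ae ?_
    filter_upwards [hX.2] with w hw
    rw [hw]
  rwa [h2, ← mul_assoc] at h1

/-! ### Polynomial decay from two weights. -/

/-- The growth factor `(1 + 1/(n+K))^p` is at most `exp(p/(n+K))`, while `1 - x ≤ exp(-x) ≤
exp(-p/(n+K))`. With `x = γδ/n^β` this is the condition on the weight `(n+K)^p` with `r = 0`. -/
theorem rpow_step {p K x n : ℝ} (hp : 0 < p) (hn : 0 < n + K) (hx : p ≤ x * (n + K)) :
    (n + 1 + K) ^ p * (1 - x) ≤ (n + K) ^ p := by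
  have h1 : n + 1 + K ≤ (n + K) * Real.exp (1 / (n + K)) := by
    have := mul_le_mul_of_nonneg_left (Real.add_one_le_exp (1 / (n + K))) hn.le
    have h2 : (n + K) * (1 / (n + K) + 1) = n + 1 + K := by field_simp; ring
    linarith
  have h2 : (n + 1 + K) ^ p ≤ (n + K) ^ p * Real.exp (p / (n + K)) := by
    refine (Real.rpow_le_rpow (by linarith) h1 hp.le).trans_eq ?_
    rw [Real.mul_rpow hn.le (Real.exp_pos _).le, ← Real.exp_mul]
    congr 2; ring
  have h3 : 1 - x ≤ Real.exp (-(p / (n + K))) := by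
    have h4 : p / (n + K) ≤ x := by rwa [div_le_iff₀ hn]
    exact (Real.one_sub_le_exp_neg x).trans (Real.exp_le_exp.2 (neg_le_neg h4))
  calc (n + 1 + K) ^ p * (1 - x) ≤ (n + 1 + K) ^ p * Real.exp (-(p / (n + K))) :=
        mul_le_mul_of_nonneg_left h3 (Real.rpow_nonneg (by linarith) _)
    _ ≤ ((n + K) ^ p * Real.exp (p / (n + K))) * Real.exp (-(p / (n + K))) :=
        mul_le_mul_of_nonneg_right h2 (Real.exp_pos _).le
    _ = (n + K) ^ p := by rw [mul_assoc, ← Real.exp_add]; simp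

/-- This is `u ≤ exp u` at `u = a t / p`, raised to the power `p` and inverted. -/
theorem exp_neg_mul_le_rpow {a p t : ℝ} (ha : 0 < a) (hp : 0 < p) (ht : 0 < t) :
    Real.exp (-(a * t)) ≤ (p / a) ^ p * t ^ (-p) := by
  have h1 : a * t / p ≤ Real.exp (a * t / p) := by linarith [Real.add_one_le_exp (a * t / p)]
  have h2 : (a * t / p) ^ p ≤ Real.exp (a * t) := by
    refine (Real.rpow_le_rpow (by positivity) h1 hp.le).trans_eq ?_
    rw [← Real.exp_mul]; congr 1; field_simp
  have h3 : (p / a) ^ p * t ^ (-p) = ((a * t / p) ^ p)⁻¹ := by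
    rw [Real.rpow_neg ht.le, ← Real.inv_rpow ht.le, ← Real.mul_rpow (by positivity) (by positivity),
      ← Real.inv_rpow (by positivity)]
    congr 1; field_simp
  rw [h3, Real.exp_neg]
  exact inv_anti₀ (by positivity) h2

/-- Polynomial decay of `E[G(X_t)]`, by comparison of the weights `(N + K)^p` and `2^{-N}`. -/
theorem ImprovementFactor.exists_integral_le_rpow (hG : IsGlobalError G)
    (h : ImprovementFactor lam G γ δ β) (hγδ : 0 < γ * δ) {p K : ℝ} (hp : 0 < p) (hK : 0 ≤ K)
    (hpK : ∀ n : ℕ, 1 ≤ n → p * (n : ℝ) ^ β ≤ γ * δ * (n + K)) :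
    ∃ c : ℝ, 0 < c ∧ ∀ (W : Type*) [MeasurableSpace W] (Pr : Measure W) [IsProbabilityMeasure Pr]
      (X : ℝ≥0 → W → Config α), IsGreedyProcess lam Pr X → ∀ t : ℝ≥0, 1 ≤ t →
        ∫ w, G (X t w) ∂Pr ≤ c * (t : ℝ) ^ (-p) * ∫ w, G (X 0 w) ∂Pr := by
  -- The decay rate left when the coefficient `2^{t/2}` of the weight `2^{-N}` meets its decay
  -- `exp(-t/2)`.
  have hlog : 0 < (1 - Real.log 2) / 2 := by linarith [Real.log_two_lt_d9]
  refine ⟨2 ^ p * (1 + K) ^ p + (p / ((1 - Real.log 2) / 2)) ^ p, by positivity, ?_⟩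
  intro W _ Pr _ X hX t ht
  have ht' : (1 : ℝ) ≤ t := by exact_mod_cast ht
  have ht0 : (0 : ℝ) < t := by linarith
  have hx0 : ∀ n : ℕ, 0 ≤ γ * δ / (n : ℝ) ^ β := fun n => by positivity
  -- Truncation keeps the weight bounded, as the generator hypothesis requires; since `M ≥ t/2`, the
  -- lower bound on `N ≥ t/2` survives it.
  set M : ℕ := ⌈(t : ℝ)⌉₊ with hM
  have hM1 : 1 ≤ M := Nat.one_le_ceil_iff.2 ht0
  set ψ : ℕ → ℝ := fun n => ((min n M : ℕ) + K) ^ p with hψ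
  have hψ0 : ∀ n, 0 ≤ ψ n := fun n => by positivity
  have hψC : ∀ n, ψ n ≤ ((M : ℝ) + K) ^ p := fun n =>
    Real.rpow_le_rpow (by positivity)
      (add_le_add_left (Nat.cast_le.2 (min_le_right n M)) K) hp.le
  have hψs : ∀ n : ℕ, 1 ≤ n → ψ (n + 1) * (1 - γ * δ / (n : ℝ) ^ β) ≤ (1 - 0) * ψ n := by
    intro n hn
    rw [sub_zero, one_mul]
    have hn' : (0 : ℝ) < n := by exact_mod_cast hn
    rcases lt_or_ge n M with hlt | hge
    · simp only [hψ, min_eq_left hlt.le, min_eq_left (Nat.succ_le_of_lt hlt)]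
      push_cast
      refine rpow_step hp (by positivity) ?_
      rw [div_mul_eq_mul_div, le_div_iff₀ (by positivity)]
      exact hpK n hn
    · simp only [hψ, min_eq_right hge, min_eq_right (hge.trans n.le_succ)]
      exact mul_le_of_le_one_right (by positivity) (by linarith [hx0 n])
  set φ : ℕ → ℝ := fun n => (1 / 2 : ℝ) ^ n with hφ
  have hφ0 : ∀ n, 0 ≤ φ n := fun n => by positivity
  have hφC : ∀ n, φ n ≤ 1 := fun n => pow_le_one₀ (by norm_num) (by norm_num)
  have hφs : ∀ n : ℕ, 1 ≤ n → φ (n + 1) * (1 - γ * δ / (n : ℝ) ^ β) ≤ (1 - 1 / 2) * φ n := by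
    intro n _
    have h1 : φ (n + 1) = (1 - 1 / 2) * φ n := by simp only [hφ, pow_succ]; ring
    rw [h1]
    exact mul_le_of_le_one_right (mul_nonneg (by norm_num) (hφ0 n)) (by linarith [hx0 n])
  have hA := hX.integral_weight_le hG h hψ0 hψC hψs t
  have hB := hX.integral_weight_le hG h hφ0 hφC hφs t
  set E : ℝ := ∫ w, G (X 0 w) ∂Pr with hE
  have hE0 : 0 ≤ E := integral_nonneg fun w => hG.nonneg _
  set a : ℝ := ((t : ℝ) / 2) ^ (-p) with ha
  set b : ℝ := Real.exp (Real.log 2 * (t / 2)) with hb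
  have ha0 : 0 ≤ a := by positivity
  -- For `n ≥ t/2` the first term alone reaches `1`; for `n < t/2` the second does, as `b * φ n =
  -- 2^{t/2 - n}`.
  have hpt : ∀ n : ℕ, 1 ≤ a * ψ n + b * φ n := by
    intro n
    rcases le_or_gt ((t : ℝ) / 2) n with hn | hn
    · have h1 : (t : ℝ) / 2 ≤ (min n M : ℕ) + K := by
        have : (t : ℝ) / 2 ≤ M := by linarith [Nat.le_ceil (t : ℝ)]
        have : (t : ℝ) / 2 ≤ (min n M : ℕ) := by rw [Nat.cast_min]; exact le_min hn this
        linarith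
      have h2 : 1 ≤ a * ψ n := by
        have h3 := Real.rpow_le_rpow (by positivity) h1 hp.le
        have h4 : a * ((t : ℝ) / 2) ^ p = 1 := by
          rw [ha, ← Real.rpow_add (by positivity)]; simp
        exact h4.symm.le.trans (mul_le_mul_of_nonneg_left h3 ha0)
      have : 0 ≤ b * φ n := by positivity
      linarith
    · have h1 : φ n = Real.exp (-(Real.log 2 * n)) := by
        rw [Real.exp_neg, Real.exp_mul, Real.exp_log two_pos, Real.rpow_natCast]
        simp [hφ]
      have h2 : 1 ≤ b * φ n := by
        rw [h1, hb, ← Real.exp_add]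
        refine Real.one_le_exp ?_
        nlinarith [Real.log_pos one_lt_two]
      have := mul_nonneg ha0 (hψ0 n)
      linarith
  have hIA := (hG.isBoundedMeasurable_weight hψ0 hψC).integrable_comp Pr (hX.measurable t)
  have hIB := (hG.isBoundedMeasurable_weight hφ0 hφC).integrable_comp Pr (hX.measurable t)
  have hIG : Integrable (fun w => G (X t w)) Pr := by
    simpa using (hG.isBoundedMeasurable_weight (ψ := fun _ => 1) (fun _ => zero_le_one)
      (fun _ => le_rfl)).integrable_comp Pr (hX.measurable t)
  have hsum : ∫ w, G (X t w) ∂Pr ≤ a * (∫ w, ψ (X t w).count * G (X t w) ∂Pr) +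
      b * ∫ w, φ (X t w).count * G (X t w) ∂Pr := by
    rw [← integral_const_mul, ← integral_const_mul,
      ← integral_add (hIA.const_mul a) (hIB.const_mul b)]
    refine integral_mono hIG ((hIA.const_mul a).add (hIB.const_mul b)) fun w => ?_
    have := mul_le_mul_of_nonneg_right (hpt (X t w).count) (hG.nonneg (X t w))
    simp only
    linarith
  have hA' : a * (∫ w, ψ (X t w).count * G (X t w) ∂Pr) ≤
      2 ^ p * (1 + K) ^ p * (t : ℝ) ^ (-p) * E := by
    have h1 := mul_le_mul_of_nonneg_left hA ha0
    have h2 : ψ 1 = (1 + K) ^ p := by simp [hψ, hM1]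
    have h3 : a = 2 ^ p * (t : ℝ) ^ (-p) := by
      rw [ha, Real.div_rpow ht0.le two_pos.le, Real.rpow_neg two_pos.le]; field_simp
    refine h1.trans_eq ?_
    rw [h2, h3]
    simp; ring
  have hB' : b * (∫ w, φ (X t w).count * G (X t w) ∂Pr) ≤
      (p / ((1 - Real.log 2) / 2)) ^ p * (t : ℝ) ^ (-p) * E := by
    have h1 := mul_le_mul_of_nonneg_left hB (Real.exp_pos (Real.log 2 * (t / 2))).le
    refine h1.trans ?_
    have h2 : φ 1 ≤ 1 := hφC 1
    have h3 : Real.exp (Real.log 2 * (t / 2)) * Real.exp (-(1 / 2) * t) =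
        Real.exp (-((1 - Real.log 2) / 2 * t)) := by
      rw [← Real.exp_add]; congr 1; ring
    calc Real.exp (Real.log 2 * (t / 2)) * (Real.exp (-(1 / 2) * t) * φ 1 * E)
        = Real.exp (-((1 - Real.log 2) / 2 * t)) * (φ 1 * E) := by rw [← h3]; ring
      _ ≤ Real.exp (-((1 - Real.log 2) / 2 * t)) * E :=
          mul_le_mul_of_nonneg_left (mul_le_of_le_one_left hE0 h2) (Real.exp_pos _).le
      _ ≤ _ := mul_le_mul_of_nonneg_right (exp_neg_mul_le_rpow hlog hp ht0) hE0
  linarith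

/-! ### Choice of the exponent for each `β`. -/

/-- With `A^{1-β} = p/q`, bounding both bases by `n + A` gives `A^{1-β} n^β ≤ n + A`, so `K = A`
works. Thus for `β < 1` the shift `K` makes every exponent `p` admissible. -/
theorem exists_mul_rpow_le {p q β : ℝ} (hp : 0 ≤ p) (hq : 0 < q) (hβ : β ∈ Set.Ico (0 : ℝ) 1) :
    ∃ K : ℝ, 0 ≤ K ∧ ∀ n : ℝ, 0 < n → p * n ^ β ≤ q * (n + K) := by
  have h1β : 0 < 1 - β := sub_pos.2 hβ.2
  set A : ℝ := (p / q) ^ (1 / (1 - β)) with hA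
  have hA0 : 0 ≤ A := by positivity
  have hAp : A ^ (1 - β) = p / q := by
    rw [hA, ← Real.rpow_mul (by positivity), one_div_mul_cancel h1β.ne', Real.rpow_one]
  refine ⟨A, hA0, fun n hn => ?_⟩
  have key : p / q * n ^ β ≤ n + A := by
    rw [← hAp]
    have h := Real.rpow_le_rpow hA0 (by linarith : A ≤ n + A) h1β.le
    have h' := Real.rpow_le_rpow hn.le (by linarith : n ≤ n + A) hβ.1
    calc A ^ (1 - β) * n ^ β ≤ (n + A) ^ (1 - β) * (n + A) ^ β := by gcongr
      _ = n + A := by rw [← Real.rpow_add (by linarith)]; simp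
  calc p * n ^ β = q * (p / q * n ^ β) := by field_simp
    _ ≤ q * (n + A) := mul_le_mul_of_nonneg_left key hq.le

/-- A logarithm is below any power: `log(1+t) ≤ (1+t)^p / p ≤ (2t)^p / p` for `t ≥ 1`. -/
theorem exists_rpow_neg_le_inv_log {p : ℝ} (hp : 0 < p) :
    ∃ c : ℝ, 0 < c ∧ ∀ t : ℝ, 1 ≤ t → t ^ (-p) ≤ c * (1 / Real.log (1 + t)) := by
  refine ⟨2 ^ p / p, by positivity, fun t ht => ?_⟩
  have h1 : Real.log (1 + t) ≤ 2 ^ p / p * t ^ p := by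
    refine (Real.log_le_rpow_div (by linarith) hp).trans ?_
    rw [div_mul_eq_mul_div, ← Real.mul_rpow two_pos.le (by linarith)]
    gcongr
    linarith
  have h2 : 0 < Real.log (1 + t) := Real.log_pos (by linarith)
  rw [mul_one_div, le_div_iff₀ h2, Real.rpow_neg (by linarith), inv_mul_le_iff₀ (by positivity)]
  linarith

/-- Decay of `E[G(X_t)]` at the rate `greedyRate`. -/
theorem ImprovementFactor.exists_integral_le (hG : IsGlobalError G)
    (h : ImprovementFactor lam G γ δ β) (hγδ : 0 < γ * δ) (hβ : β ∈ Set.Icc (0 : ℝ) 1) :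
    ∃ c : ℝ, 0 < c ∧ ∀ (W : Type*) [MeasurableSpace W] (Pr : Measure W) [IsProbabilityMeasure Pr]
      (X : ℝ≥0 → W → Config α), IsGreedyProcess lam Pr X → ∀ t : ℝ≥0, 1 ≤ t →
        ∫ w, G (X t w) ∂Pr ≤ c * greedyRate γ δ β t * ∫ w, G (X 0 w) ∂Pr := by
  unfold greedyRate
  rcases eq_or_ne β 0 with rfl | hβ0
  · refine ⟨1, one_pos, fun W _ Pr _ X hX t _ => ?_⟩
    simpa using hX.integral_weight_le hG h (ψ := fun _ => 1) (C := 1) (r := γ * δ)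
      (fun _ => zero_le_one) (fun _ => le_rfl) (fun n _ => by simp) t
  have hβpos : 0 < β := lt_of_le_of_ne hβ.1 hβ0.symm
  rcases lt_or_eq_of_le hβ.2 with hβ1 | rfl
  -- Here `p = 1/β - 1` is taken only to match the stated rate.
  · have hp : 0 < 1 / β - 1 := by rw [sub_pos, lt_div_iff₀ hβpos]; linarith
    obtain ⟨K, hK, hpK⟩ := exists_mul_rpow_le hp.le hγδ ⟨hβ.1, hβ1⟩
    obtain ⟨c, hc, hcX⟩ := h.exists_integral_le_rpow hG hγδ hp hK
      (fun n hn => hpK n (by exact_mod_cast hn))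
    refine ⟨c, hc, fun W _ Pr _ X hX t ht => ?_⟩
    simpa [hβ0, hβ1] using hcX W Pr X hX t ht
  -- At `β = 1` the condition `p n ≤ γδ (n + K)` for all `n` forces `p ≤ γδ`. Taking `p = γδ`, `K =
  -- 0` gives `t^{-γδ}`, then weakened to the logarithmic rate.
  · obtain ⟨c, hc, hcX⟩ := h.exists_integral_le_rpow hG hγδ hγδ le_rfl (fun n _ => by simp)
    obtain ⟨c', hc', hlog⟩ := exists_rpow_neg_le_inv_log hγδ
    refine ⟨c * c', by positivity, fun W _ Pr _ X hX t ht => ?_⟩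
    refine (hcX W Pr X hX t ht).trans ?_
    simp only [hβ0, lt_irrefl, if_false]
    rw [mul_assoc c c']
    exact mul_le_mul_of_nonneg_right
      (mul_le_mul_of_nonneg_left (hlog t (by exact_mod_cast ht)) hc.le)
      (integral_nonneg fun w => hG.nonneg _)

theorem tendsto_greedyRate (hγδ : 0 < γ * δ) (hβ : β ∈ Set.Icc (0 : ℝ) 1) :
    Tendsto (greedyRate γ δ β) atTop (𝓝 0) := by
  unfold greedyRate
  rcases eq_or_ne β 0 with rfl | hβ0
  · simp only [if_true]
    exact Real.tendsto_exp_neg_atTop_nhds_zero.comp (tendsto_id.const_mul_atTop hγδ)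
  have hβpos : 0 < β := lt_of_le_of_ne hβ.1 hβ0.symm
  rcases lt_or_eq_of_le hβ.2 with hβ1 | rfl
  · simp only [hβ0, hβ1, if_true, if_false]
    have hp : 0 < 1 / β - 1 := by rw [sub_pos, lt_div_iff₀ hβpos]; linarith
    simpa using tendsto_rpow_neg_atTop hp
  · simp only [hβ0, lt_irrefl, if_false, one_div]
    exact tendsto_inv_atTop_zero.comp
      (Real.tendsto_log_atTop.comp (tendsto_atTop_add_const_left _ 1 tendsto_id))

end Greedy

/-! ### Markov's inequality and convergence in probability. -/

theorem mainTheorem1 {d : ℕ} (P : Set (EuclideanSpace ℝ (Fin d))) (hP : IsCompact P)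
    (lam : Kernel (Config P) P) [IsMarkovKernel lam]
    (G : Config P → ℝ) (hG : IsGlobalError G)
    (γ δ β : ℝ) (hγ : γ ∈ Set.Ioo (0 : ℝ) 1) (hδ : 0 < δ) (hβ : β ∈ Set.Icc (0 : ℝ) 1)
    (hGimp : ImprovementFactor lam G γ δ β) :
    ∃ c : ℝ, 0 < c ∧
      ∀ (W : Type*) [MeasurableSpace W] (Pr : Measure W) [IsProbabilityMeasure Pr]
        (X : ℝ≥0 → W → Config P), IsGreedyProcess lam Pr X →
        (∀ ε : ℝ, 0 < ε → ∀ t : ℝ≥0, 1 ≤ t →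
          Pr.real {w | ε < G (X t w)} ≤ c / ε * (∫ w, G (X 0 w) ∂Pr) * greedyRate γ δ β t) ∧
        TendstoInMeasure Pr (fun (t : ℝ≥0) (w : W) => G (X t w)) atTop (fun _ => (0 : ℝ)) := by
  have hγδ : 0 < γ * δ := mul_pos hγ.1 hδ
  obtain ⟨c, hc, hcX⟩ := hGimp.exists_integral_le hG hγδ hβ
  refine ⟨c, hc, fun W _ Pr _ X hX => ?_⟩
  -- The non-strict event serves both conclusions: it contains the strict one, and convergence in
  -- measure is tested on `ε ≤ ‖·‖`.
  have bound : ∀ ε : ℝ, 0 < ε → ∀ t : ℝ≥0, 1 ≤ t →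
      Pr.real {w | ε ≤ G (X t w)} ≤ c / ε * (∫ w, G (X 0 w) ∂Pr) * greedyRate γ δ β t := by
    intro ε hε t ht
    have hI : Integrable (fun w => G (X t w)) Pr := by
      simpa using (hG.isBoundedMeasurable_weight (ψ := fun _ => 1) (fun _ => zero_le_one)
        (fun _ => le_rfl)).integrable_comp Pr (hX.measurable t)
    have h1 := mul_meas_ge_le_integral_of_nonneg (ae_of_all _ fun w => hG.nonneg (X t w)) hI ε
    have h2 := h1.trans (hcX W Pr X hX t ht)
    rw [← le_div_iff₀' hε] at h2
    refine h2.trans_eq ?_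
    ring
  refine ⟨fun ε hε t ht => 
    (measureReal_mono (Set.ofPred_subset_ofPred.2 fun w hw => le_of_lt hw)).trans (bound ε hε t ht), ?_⟩
  rw [tendstoInMeasure_iff_measureReal_norm]
  intro ε hε
  have hlim : Tendsto (fun t : ℝ≥0 => c / ε * (∫ w, G (X 0 w) ∂Pr) * greedyRate γ δ β t) atTop
      (𝓝 0) := by
    simpa using ((tendsto_greedyRate hγδ hβ).comp
      (NNReal.tendsto_coe_atTop.2 tendsto_id)).const_mul (c / ε * ∫ w, G (X 0 w) ∂Pr)
  refine squeeze_zero' (Eventually.of_forall fun t => measureReal_nonneg) ?_ hlim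
  filter_upwards [eventually_ge_atTop 1] with t ht
  simpa [Real.norm_of_nonneg (hG.nonneg _)] using bound ε hε t ht
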